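/- A behavior is a table $P(a,b|x,y)$ with $a,b,x,y\in\{0,1\}$. It is called quantum if $P(a,b|x,y)=\mathrm{Tr}[(A_{a|x}\otimes B_{b|y})\rho]$ for some density operator $\rho$ on a tensor product $H_A\otimes H_B$ of complex Hilbert spaces and some two-outcome measurements (POVMs) $\{A_{a|x}\}_a$ on $H_A$ and $\{B_{b|y}\}_b$ on $H_B$; let $P(a|x)=\sum_b P(a,b|x,y)$ denote Alice's marginal (for a quantum behavior it does not depend on $y$). Fix Eve's target input $x^*\in\{0,1\}$ and a bias $r\in[1/2,1)$. Let $\pi_{xy}=\pi_x/2$ with $\pi_{x^*}=r$ and $\pi_{1-x^*}=1-r$ (Alice's input is biased towards $x^*$, Bob's input is independent and uniform). The average score of a behavior in the corresponding biased CHSH game is $$V_\pi[P]=4\sum_{a,b,x,y}\pi_{xy}\,P(a,b|x,y)\,(-1)^{a+b+xy}.$$ For $S\in\mathbb{R}$, let $G_{x^*}(S)$ be the maximum of Eve's guessing probability $$\sum_\lambda q_\lambda\max_{a}P_\lambda(a|x^*)$$ over all discrete probability distributions $(q_\lambda)$ and all families of quantum behaviors $(P_\lambda)$ such that $V_\pi\big[\sum_\lambda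 q_\lambda P_\lambda\big]=S$. Then for every $S\in\big[4r,\,4\sqrt{r^2+(1-r)^2}\big]$ the maximum is attained and $$G_{x^*}(S)=\frac12\left\{1+\sqrt{1-\frac{1}{(1-r)^2}\left[\left(\frac S4\right)^2-r^2\right]}\right\}.$$ For $r=1/2$ the score $V_\pi[P]$ is the standard CHSH value $S[P]=\sum_{a,b,x,y}(-1)^{a+b+xy}P(a,b|x,y)$, and the formula reduces to the standard one, $\frac12\big[1+\sqrt{2-(S/2)^2}\big]$. -/

import Mathlib

open scoped TensorProduct InnerProductSpace

noncomputable section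

namespace BiasedCHSH

/-- The completed (Hilbert-space) tensor product of two Hilbert spaces. -/
abbrev HTensor (H K : Type) [NormedAddCommGroup H] [InnerProductSpace ℂ H]
    [NormedAddCommGroup K] [InnerProductSpace ℂ K] : Type :=
  UniformSpace.Completion (H ⊗[ℂ] K)

/-- The bounded operator `A ⊗ B` on the Hilbert-space tensor product. -/
def opTensor {H K : Type} [NormedAddCommGroup H] [InnerProductSpace ℂ H]
    [NormedAddCommGroup K] [InnerProductSpace ℂ K]
    (A : H →L[ℂ] H) (B : K →L[ℂ] K) : HTensor H K →L[ℂ] HTensor H K :=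
  (TensorProduct.mapL A B).completion

/-- `T` has trace `t`: in every Hilbert basis the diagonal matrix elements of `T` sum
(unconditionally) to `t`. -/
def HasTrace {H : Type} [NormedAddCommGroup H] [InnerProductSpace ℂ H]
    (T : H →L[ℂ] H) (t : ℂ) : Prop :=
  ∀ (ι : Type) (e : HilbertBasis ι ℂ H), HasSum (fun i => ⟪e i, T (e i)⟫_ℂ) t

/-- A density operator: positive with trace one. -/
def IsDensity {H : Type} [NormedAddCommGroup H] [InnerProductSpace ℂ H]
    (ρ : H →L[ℂ] H) : Prop :=
  ρ.IsPositive ∧ HasTrace ρ 1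

/-- A two-outcome measurement (POVM). -/
def IsPOVM {H : Type} [NormedAddCommGroup H] [InnerProductSpace ℂ H]
    (M : Fin 2 → (H →L[ℂ] H)) : Prop :=
  (∀ a, (M a).IsPositive) ∧ ∑ a, M a = 1

/-- A table `P a b x y` standing for the probabilities `P(a,b|x,y)`. -/
abbrev Behavior : Type := Fin 2 → Fin 2 → Fin 2 → Fin 2 → ℝ

/-- `P` is quantum: `P(a,b|x,y) = Tr[(A_{a|x} ⊗ B_{b|y}) ρ]` for local measurements and a
bipartite state on Hilbert spaces of arbitrary (possibly infinite) dimension. -/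
def IsQuantum (P : Behavior) : Prop :=
  ∃ (H : Type) (_ : NormedAddCommGroup H) (_ : InnerProductSpace ℂ H) (_ : CompleteSpace H)
    (K : Type) (_ : NormedAddCommGroup K) (_ : InnerProductSpace ℂ K) (_ : CompleteSpace K)
    (A : Fin 2 → Fin 2 → (H →L[ℂ] H)) (B : Fin 2 → Fin 2 → (K →L[ℂ] K))
    (ρ : HTensor H K →L[ℂ] HTensor H K),
    (∀ x, IsPOVM (A x)) ∧ (∀ y, IsPOVM (B y)) ∧ IsDensity ρ ∧
    ∀ a b x y, HasTrace (opTensor (A x a) (B y b) ∘L ρ) (P a b x y : ℂ)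

/-- Alice's marginal `P(a|x)`. Quantum behaviors are no-signaling, so Bob's input, set to `0`
here, is immaterial. -/
def marginal (P : Behavior) (a x : Fin 2) : ℝ := ∑ b, P a b x 0

/-- The average score of `P` in the CHSH game with input distribution `π`, a win
(`a + b = x y` mod 2) scoring `4` and a loss `-4`. -/
def score (π : Fin 2 → Fin 2 → ℝ) (P : Behavior) : ℝ :=
  4 * ∑ a : Fin 2, ∑ b : Fin 2, ∑ x : Fin 2, ∑ y : Fin 2,
    π x y * P a b x y * (-1 : ℝ) ^ (a.val + b.val + x.val * y.val)

/-- The CHSH functional. -/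
def chsh (P : Behavior) : ℝ :=
  ∑ a : Fin 2, ∑ b : Fin 2, ∑ x : Fin 2, ∑ y : Fin 2,
    (-1 : ℝ) ^ (a.val + b.val + x.val * y.val) * P a b x y

/-- Alice's input equals `xs` with probability `r`; Bob's input is independent and uniform. -/
def biasedInputs (r : ℝ) (xs : Fin 2) (x _y : Fin 2) : ℝ :=
  (if x = xs then r else 1 - r) * (1 / 2)

/-- The average behavior `∑_l q_l P_l`. -/
def average {Λ : Type} (q : Λ → ℝ) (P : Λ → Behavior) : Behavior :=
  fun a b x y => ∑' l, q l * P l a b x y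

/-- All values of Eve's guessing probability of Alice's output for input `xs` compatible with
the value `S` of the functional `V`: a hidden variable `l` has distribution `q`, each `P l` is
quantum, the average behavior satisfies `V = S`, and Eve, knowing `l`, guesses the most likely
output. -/
def guessingValues (V : Behavior → ℝ) (xs : Fin 2) (S : ℝ) : Set ℝ :=
  {g | ∃ (Λ : Type) (q : Λ → ℝ) (P : Λ → Behavior),
    (∀ l, 0 ≤ q l) ∧ HasSum q 1 ∧ (∀ l, IsQuantum (P l)) ∧ V (average q P) = S ∧
    g = ∑' l, q l * max (marginal (P l) 0 xs) (marginal (P l) 1 xs)}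

/-- The closed formula for the guessing probability in the biased game. -/
def guessFormula (r S : ℝ) : ℝ :=
  1 / 2 * (1 + √(1 - 1 / (1 - r) ^ 2 * ((S / 4) ^ 2 - r ^ 2)))

end BiasedCHSH

end

open scoped TensorProduct InnerProductSpace

noncomputable section

namespace BiasedCHSH

/-! ### Positive operators and the Hilbert-space tensor product -/

section Sqrt

variable {X : Type} [NormedAddCommGroup X] [InnerProductSpace ℂ X] [CompleteSpace X]

/-! Write `s = 1 - r`, `V` for the score, and `p`, `q` for Alice's two marginals at the guessed
input. The heart of the upper bound is the quadratic inequality `(V/4)² + s²(p - q)² ≤ (r² + s²)(p +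
q)²`, proved for a possibly unnormalized vector in a commuting-operator model.

With `e²`, `f²` the effects of the guessed measurement, the vector `ψ` splits into `e ψ` and `f ψ`.
The score operator has a diagonal part on each piece and a cross term from Alice's other observable.
A sum-of-squares identity (`sector_identity`, `sector_bound`) shows that a large cross term costs
diagonal score, and `le_of_sectors` optimizes this trade-off, giving `vector_bound`. Square roots of
effects replace projections, so no dilation is needed.

The quadratic bound does not add up over mixtures, but its tangent half-planes do.
`linear_le_of_le_sqrt` therefore turns it into linear tilted Bell inequalities, which are summed
first over the vectors representing a density operator (`IsQuantum.exists_commuting`,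
`IsQuantum.tilted_le`) and then over Eve's variable. Choosing the tilt along the averaged point
itself recovers the quadratic bound for the mixture (`guessingValues_le`).

For attainment one behavior suffices: a partially entangled two-qubit state, with Alice's guessed
measurement in the Schmidt basis (`guessFormula_mem`). -/

theorem exists_symm_sqrt {T : X →L[ℂ] X} (hT : T.IsPositive) :
    ∃ Q : X →L[ℂ] X, Q * Q = T ∧ ∀ x y, ⟪Q x, y⟫_ℂ = ⟪x, Q y⟫_ℂ := by
  have hT0 : 0 ≤ T := (ContinuousLinearMap.nonneg_iff_isPositive T).2 hT
  exact ⟨CFC.sqrt T, CFC.sqrt_mul_sqrt_self T hT0,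
    (CFC.sqrt_nonneg T).isSelfAdjoint.isSymmetric⟩

theorem isPositive_mul_self {Q : X →L[ℂ] X} (hQ : ∀ x y, ⟪Q x, y⟫_ℂ = ⟪x, Q y⟫_ℂ) :
    (Q * Q).IsPositive := by
  have h : IsSelfAdjoint Q := ContinuousLinearMap.isSelfAdjoint_iff_isSymmetric.mpr hQ
  rw [← ContinuousLinearMap.nonneg_iff_isPositive]
  exact h.mul_self_nonneg

end Sqrt

section OpTensor

variable {H K : Type} [NormedAddCommGroup H] [InnerProductSpace ℂ H]
  [NormedAddCommGroup K] [InnerProductSpace ℂ K]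

theorem opTensor_coe (A : H →L[ℂ] H) (B : K →L[ℂ] K) (x : H ⊗[ℂ] K) :
    opTensor A B (x : HTensor H K) = ((TensorProduct.mapL A B x : H ⊗[ℂ] K) : HTensor H K) :=
  ContinuousLinearMap.completion_apply_coe _ _

/-- Bounded operators on the Hilbert-space tensor product agreeing on the algebraic tensor
product are equal. -/
theorem HTensor.clm_ext {S T : HTensor H K →L[ℂ] HTensor H K}
    (h : ∀ x : H ⊗[ℂ] K, S (x : HTensor H K) = T (x : HTensor H K)) : S = T := by
  ext x
  induction x using UniformSpace.Completion.induction_on with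
  | hp => exact isClosed_eq S.continuous T.continuous
  | ih x => exact h x

theorem opTensor_mul (A A' : H →L[ℂ] H) (B B' : K →L[ℂ] K) :
    opTensor (A * A') (B * B') = opTensor A B * opTensor A' B' := by
  refine HTensor.clm_ext fun x => ?_
  rw [mul_apply_eq_comp, opTensor_coe, opTensor_coe, opTensor_coe,
    TensorProduct.mapL_mul, mul_apply_eq_comp]

theorem opTensor_one : opTensor (1 : H →L[ℂ] H) (1 : K →L[ℂ] K) = 1 := by
  refine HTensor.clm_ext fun x => ?_
  rw [opTensor_coe]
  have : TensorProduct.mapL (1 : H →L[ℂ] H) (1 : K →L[ℂ] K) = 1 := TensorProduct.mapL_id_id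
  rw [this]; rfl

theorem opTensor_add_left (A A' : H →L[ℂ] H) (B : K →L[ℂ] K) :
    opTensor (A + A') B = opTensor A B + opTensor A' B := by
  refine HTensor.clm_ext fun x => ?_
  rw [add_apply, opTensor_coe, opTensor_coe, opTensor_coe,
    TensorProduct.mapL_add_left, add_apply, UniformSpace.Completion.coe_add]

theorem opTensor_add_right (A : H →L[ℂ] H) (B B' : K →L[ℂ] K) :
    opTensor A (B + B') = opTensor A B + opTensor A B' := by
  refine HTensor.clm_ext fun x => ?_
  rw [add_apply, opTensor_coe, opTensor_coe, opTensor_coe,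
    TensorProduct.mapL_add_right, add_apply, UniformSpace.Completion.coe_add]

theorem opTensor_symm {A : H →L[ℂ] H} {B : K →L[ℂ] K}
    (hA : ∀ x y, ⟪A x, y⟫_ℂ = ⟪x, A y⟫_ℂ) (hB : ∀ x y, ⟪B x, y⟫_ℂ = ⟪x, B y⟫_ℂ)
    (x y : HTensor H K) : ⟪opTensor A B x, y⟫_ℂ = ⟪x, opTensor A B y⟫_ℂ := by
  induction x, y using UniformSpace.Completion.induction_on₂ with
  | hp => exact isClosed_eq (by fun_prop) (by fun_prop)
  | ih x y =>
    rw [opTensor_coe, opTensor_coe, UniformSpace.Completion.inner_coe,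
      UniformSpace.Completion.inner_coe]
    induction x with
    | zero => simp
    | add x x' hx hx' => rw [map_add, inner_add_left, inner_add_left, hx, hx']
    | tmul x x' =>
      induction y with
      | zero => simp
      | add y y' hy hy' => rw [map_add, inner_add_right, inner_add_right, hy, hy']
      | tmul y y' => simp [hA, hB]

/-- If `A = Q²` and `B = R²`, then `A ⊗ B` is the square of the symmetric operator `Q ⊗ R`. -/
theorem opTensor_isPositive [CompleteSpace H] [CompleteSpace K] {A : H →L[ℂ] H}
    {B : K →L[ℂ] K} (hA : A.IsPositive) (hB : B.IsPositive) : (opTensor A B).IsPositive := by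
  obtain ⟨Q, rfl, hQ⟩ := exists_symm_sqrt hA
  obtain ⟨R, rfl, hR⟩ := exists_symm_sqrt hB
  rw [opTensor_mul]
  exact isPositive_mul_self (opTensor_symm hQ hR)

end OpTensor

/-! ### Traces in a Hilbert basis -/

section Trace

variable {H : Type} [NormedAddCommGroup H] [InnerProductSpace ℂ H]

theorem hasSum_norm_inner_sq {ι : Type} (e : HilbertBasis ι ℂ H) (x : H) :
    HasSum (fun i => ‖⟪e i, x⟫_ℂ‖ ^ 2) (‖x‖ ^ 2) := by
  have h := (e.hasSum_inner_mul_inner x x).mapL Complex.reCLM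
  convert h using 1
  · ext i
    rw [← inner_conj_symm x (e i), Complex.conj_mul']
    simp [← Complex.ofReal_pow]
  · simp [inner_self_eq_norm_sq_to_K, ← Complex.ofReal_pow]

/-- For a self-adjoint Hilbert–Schmidt operator `Q`, the trace of `T Q Q` computed in a Hilbert
basis equals that of `Q T Q`. -/
theorem hasSum_inner_conj {ι : Type} (e : HilbertBasis ι ℂ H) {Q T : H →L[ℂ] H}
    (hQ : ∀ x y, ⟪Q x, y⟫_ℂ = ⟪x, Q y⟫_ℂ) (hs : Summable fun i => ‖Q (e i)‖ ^ 2) {t : ℂ}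
    (ht : HasSum (fun i => ⟪e i, T (Q (Q (e i)))⟫_ℂ) t) :
    HasSum (fun j => ⟪Q (e j), T (Q (e j))⟫_ℂ) t := by
  -- The row sums of `F` give the trace of `T Q Q`, the column sums that of `Q T Q`. Since `Q` and
  -- `T Q` are Hilbert–Schmidt, `F` is absolutely summable and the order of summation is immaterial.
  set F : ι × ι → ℂ := fun p => ⟪e p.1, T (Q (e p.2))⟫_ℂ * ⟪e p.2, Q (e p.1)⟫_ℂ with hF
  have hQ2 : Summable fun p : ι × ι => ‖⟪e p.2, Q (e p.1)⟫_ℂ‖ ^ 2 := by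
    refine (summable_prod_of_nonneg fun _ => by positivity).2
      ⟨fun i => (hasSum_norm_inner_sq e (Q (e i))).summable, ?_⟩
    simpa only [(hasSum_norm_inner_sq e _).tsum_eq] using hs
  have hTQ : Summable fun i => ‖T (Q (e i))‖ ^ 2 := by
    refine Summable.of_nonneg_of_le (fun _ => by positivity) (fun i => ?_) (hs.mul_left (‖T‖ ^ 2))
    rw [← mul_pow]
    gcongr
    exact T.le_opNorm _
  have hT2 : Summable fun p : ι × ι => ‖⟪e p.1, T (Q (e p.2))⟫_ℂ‖ ^ 2 := by
    rw [← (Equiv.prodComm ι ι).summable_iff]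
    refine (summable_prod_of_nonneg fun _ => sq_nonneg _).2
      ⟨fun i => (hasSum_norm_inner_sq e (T (Q (e i)))).summable, ?_⟩
    simpa [(hasSum_norm_inner_sq e _).tsum_eq] using hTQ
  have hFs : Summable F := by
    refine Summable.of_norm_bounded (hT2.add hQ2) fun p => ?_
    rw [norm_mul]
    nlinarith [sq_nonneg (‖⟪e p.1, T (Q (e p.2))⟫_ℂ‖ - ‖⟪e p.2, Q (e p.1)⟫_ℂ‖),
      sq_nonneg ‖⟪e p.1, T (Q (e p.2))⟫_ℂ‖, sq_nonneg ‖⟪e p.2, Q (e p.1)⟫_ℂ‖]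
  have hrow : ∀ i, HasSum (fun j => F (i, j)) ⟪e i, T (Q (Q (e i)))⟫_ℂ := by
    intro i
    have h := (e.hasSum_repr (Q (e i))).mapL ((innerSL ℂ (e i)).comp (T.comp Q))
    simpa [e.repr_apply_apply, hF, mul_comm] using h
  have hcol : ∀ j, HasSum (fun i => F (i, j)) ⟪Q (e j), T (Q (e j))⟫_ℂ := by
    intro j
    convert! e.hasSum_inner_mul_inner (Q (e j)) (T (Q (e j))) using 2
    rw [hQ, mul_comm]
  have hFt : HasSum F t := by
    rw [← (hFs.hasSum.prod_fiberwise hrow).unique ht]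
    exact hFs.hasSum
  have hFt' : HasSum (F ∘ (Equiv.prodComm ι ι)) t := (Equiv.prodComm ι ι).hasSum_iff.2 hFt
  exact hFt'.prod_fiberwise hcol

/-- A rank-one state evaluates to a vector expectation. -/
theorem hasTrace_comp_rankOne (T : H →L[ℂ] H) (ψ : H) :
    HasTrace (T ∘L InnerProductSpace.rankOne ℂ ψ ψ) ⟪ψ, T ψ⟫_ℂ := by
  intro ι e
  convert! e.hasSum_inner_mul_inner ψ (T ψ) using 2
  simp

theorem isDensity_rankOne {ψ : H} (hψ : ‖ψ‖ = 1) :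
    IsDensity (InnerProductSpace.rankOne ℂ ψ ψ) := by
  refine ⟨InnerProductSpace.isPositive_rankOne_self ψ, ?_⟩
  have h := hasTrace_comp_rankOne 1 ψ
  simpa [inner_self_eq_norm_sq_to_K, hψ, ContinuousLinearMap.one_def] using h

end Trace

/-! ### Reduction to vectors in a commuting-operator model -/

/-- Two-outcome measurements `M`, `N` on a Hilbert space such that every `M x a` commutes with
every `N y b`. -/
structure CommutingMeasurements {X : Type} [NormedAddCommGroup X] [InnerProductSpace ℂ X]
    [CompleteSpace X] (M N : Fin 2 → Fin 2 → (X →L[ℂ] X)) : Prop where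
  left_nonneg : ∀ x a, 0 ≤ M x a
  right_nonneg : ∀ y b, 0 ≤ N y b
  left_sum : ∀ x, M x 0 + M x 1 = 1
  right_sum : ∀ y, N y 0 + N y 1 = 1
  commute : ∀ x a y b, Commute (M x a) (N y b)

/-- A quantum behavior is a sum of vector expectations in a commuting-operator model. -/
theorem IsQuantum.exists_commuting {P : Behavior} (hP : IsQuantum P) :
    ∃ (X : Type) (_ : NormedAddCommGroup X) (_ : InnerProductSpace ℂ X) (_ : CompleteSpace X)
      (M N : Fin 2 → Fin 2 → (X →L[ℂ] X)) (ι : Type) (ψ : ι → X),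
      CommutingMeasurements M N ∧ HasSum (fun j => ‖ψ j‖ ^ 2) 1 ∧
      ∀ a b x y, HasSum (fun j => (⟪ψ j, (M x a * N y b) (ψ j)⟫_ℂ).re) (P a b x y) := by
  obtain ⟨H, _, _, _, K, _, _, _, A, B, ρ, hA, hB, hρ, hPρ⟩ := hP
  obtain ⟨w, e, -⟩ := exists_hilbertBasis ℂ (HTensor H K)
  obtain ⟨Q, hQQ, hQ⟩ := exists_symm_sqrt hρ.1
  have hρQ : ∀ x, ρ x = Q (Q x) := fun x => by rw [← hQQ]; rfl
  have hnorm : HasSum (fun j => ‖Q (e j)‖ ^ 2) 1 := by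
    have h := (hρ.2 w e).mapL Complex.reCLM
    convert h using 1
    · ext j
      rw [hρQ, ← hQ, inner_self_eq_norm_sq_to_K]
      simp [← Complex.ofReal_pow]
    · simp
  refine ⟨HTensor H K, inferInstance, inferInstance, inferInstance,
    fun x a => opTensor (A x a) 1, fun y b => opTensor 1 (B y b), w, fun j => Q (e j),
    ⟨?_, ?_, ?_, ?_, ?_⟩, hnorm, ?_⟩
  · exact fun x a => (ContinuousLinearMap.nonneg_iff_isPositive _).2
      (opTensor_isPositive ((hA x).1 a) ContinuousLinearMap.isPositive_one)
  · exact fun y b => (ContinuousLinearMap.nonneg_iff_isPositive _).2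
      (opTensor_isPositive ContinuousLinearMap.isPositive_one ((hB y).1 b))
  · intro x
    have := (hA x).2
    rw [Fin.sum_univ_two] at this
    rw [← opTensor_add_left, this, opTensor_one]
  · intro y
    have := (hB y).2
    rw [Fin.sum_univ_two] at this
    rw [← opTensor_add_right, this, opTensor_one]
  · intro x a y b
    rw [Commute, SemiconjBy, ← opTensor_mul, ← opTensor_mul]
    simp
  · intro a b x y
    have h := (hasSum_inner_conj e (T := opTensor (A x a) (B y b)) hQ hnorm.summable
      (t := P a b x y) (by simpa [hρQ] using hPρ a b x y w e)).mapL Complex.reCLM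
    rw [← opTensor_mul, mul_one, one_mul]
    simpa using h

/-! ### The score bound for a vector state -/

section SectorBound

variable {X : Type} [NormedAddCommGroup X] [InnerProductSpace ℂ X]

/-- A sum-of-squares certificate. Replacing `f²` by `1 - e²` turns the cross term `(e a f)(f a e)`
into `e a² e - x²`, and `(B₀ + B₁)² + D² = 2 B₀² + 2 B₁²` accounts for Bob's squares. For
contractions and `0 ≤ s ≤ r` every term on the right is positive. -/
theorem sector_identity {𝒜 : Type*} [Ring 𝒜] [Algebra ℂ 𝒜] {e f a B₀ B₁ : 𝒜}
    (hef : e * e + f * f = 1)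
    (he₀ : Commute B₀ e) (he₁ : Commute B₁ e) (hf₀ : Commute B₀ f) (hf₁ : Commute B₁ f)
    (ha₀ : Commute B₀ a) (ha₁ : Commute B₁ a) (r s : ℂ) :
    let x := e * a * e
    let D := B₀ - B₁
    let Z := r • (B₀ + B₁) + s • (x * D)
    (4 * r ^ 2) • 1 - Z * Z - r ^ 2 • ((D * (e * a * f)) * ((f * a * e) * D)) =
      (2 * r) • ((r • 1 + s • x) * (1 - B₀ * B₀)) + (2 * r) • ((r • 1 - s • x) * (1 - B₁ * B₁))
      + r ^ 2 • (D * (f * f) * D) + r ^ 2 • (D * (e * (1 - a * a) * e) * D)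
      + (r ^ 2 - s ^ 2) • ((x * D) * (x * D)) := by
  have hff : f * f = 1 - e * e := by rw [← hef]; abel
  have hff' : ∀ z, f * (f * z) = z - e * (e * z) := fun z => by
    rw [← mul_assoc, hff, sub_mul, one_mul, mul_assoc]
  have comm : ∀ {B u : 𝒜}, Commute B u → ∀ z, B * (u * z) = u * (B * z) := fun h z => by
    rw [← mul_assoc, h.eq, mul_assoc]
  intro x D Z
  simp only [x, D, Z, mul_add, add_mul, mul_sub, sub_mul, smul_mul_assoc, mul_smul_comm,
    mul_assoc, he₀.eq, he₁.eq, hf₀.eq, hf₁.eq, comm he₀, comm he₁, comm hf₀,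
    comm hf₁, comm ha₀, comm ha₁, hff, hff', mul_one, one_mul]
  module

theorem real_smul_nonneg {T : X →L[ℂ] X} (hT : 0 ≤ T) {c : ℝ} (hc : 0 ≤ c) :
    0 ≤ (c : ℂ) • T := by
  rw [ContinuousLinearMap.nonneg_iff_isPositive] at hT ⊢
  exact hT.smul_of_nonneg (by exact_mod_cast hc)

theorem re_inner_le_norm_mul (T : X →L[ℂ] X) (x y : X) : (⟪x, T y⟫_ℂ).re ≤ ‖x‖ * ‖T y‖ :=
  (Complex.re_le_norm _).trans (norm_inner_le_norm _ _)

variable [CompleteSpace X]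

theorem one_sub_mul_self_nonneg {a : X →L[ℂ] X} (h₁ : 0 ≤ 1 + a) (h₂ : 0 ≤ 1 - a) :
    0 ≤ 1 - a * a := by
  have h : Commute (1 + a) (1 - a) :=
    (Commute.one_left _).add_left ((Commute.one_right a).sub_right (Commute.refl a))
  have := h.mul_nonneg h₁ h₂
  convert this using 1
  noncomm_ring

theorem isSelfAdjoint_of_one_add_nonneg {a : X →L[ℂ] X} (h : 0 ≤ 1 + a) : IsSelfAdjoint a := by
  have := h.isSelfAdjoint.sub (IsSelfAdjoint.one (X →L[ℂ] X))
  rwa [add_sub_cancel_left] at this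

theorem conjugate_nonneg {u T : X →L[ℂ] X} (hu : IsSelfAdjoint u) (hT : 0 ≤ T) :
    0 ≤ u * T * u := by
  have h := star_left_conjugate_nonneg hT u
  rwa [hu.star_eq] at h

theorem smul_one_add_smul_nonneg {y : X →L[ℂ] X} (hy : 0 ≤ 1 + y) {r s : ℝ} (hs : 0 ≤ s)
    (hsr : s ≤ r) : 0 ≤ (r : ℂ) • 1 + (s : ℂ) • y := by
  have h := add_nonneg (real_smul_nonneg (zero_le_one (α := X →L[ℂ] X)) (sub_nonneg.2 hsr))
    (real_smul_nonneg hy hs)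
  have e : (r : ℂ) • (1 : X →L[ℂ] X) + (s : ℂ) • y
      = ((r - s : ℝ) : ℂ) • 1 + (s : ℂ) • (1 + y) := by
    push_cast
    module
  rwa [e]

theorem one_add_conjugate_nonneg {e f a : X →L[ℂ] X} (he : IsSelfAdjoint e)
    (hf : IsSelfAdjoint f) (hef : e * e + f * f = 1) (ha : 0 ≤ 1 + a) :
    0 ≤ 1 + e * a * e := by
  have h := add_nonneg hf.mul_self_nonneg (conjugate_nonneg he ha)
  have e : 1 + e * a * e = f * f + e * (1 + a) * e := by
    rw [mul_add, add_mul, mul_one, ← hef]; abel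
  rwa [e]

theorem weighted_nonneg {x B : X →L[ℂ] X} (hx : 0 ≤ 1 + x) (hB : 0 ≤ 1 + B) (hB' : 0 ≤ 1 - B)
    (h : Commute B x) {r s : ℝ} (hs : 0 ≤ s) (hsr : s ≤ r) :
    0 ≤ ((r : ℂ) • 1 + (s : ℂ) • x) * (1 - B * B) := by
  have hc : Commute ((r : ℂ) • 1 + (s : ℂ) • x) (1 - B * B) :=
    ((Commute.one_left _).smul_left _).add_left (((Commute.one_right x).sub_right
      (h.symm.mul_right h.symm)).smul_left _)
  exact hc.mul_nonneg (smul_one_add_smul_nonneg hx hs hsr) (one_sub_mul_self_nonneg hB hB')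

theorem norm_sq_add_norm_sq_le {Z W : X →L[ℂ] X} (hZ : IsSelfAdjoint Z) {c d : ℝ}
    (h : 0 ≤ (c : ℂ) • (1 : X →L[ℂ] X) - Z * Z - (d : ℂ) • (star W * W)) (φ : X) :
    ‖Z φ‖ ^ 2 + d * ‖W φ‖ ^ 2 ≤ c * ‖φ‖ ^ 2 := by
  have := ((ContinuousLinearMap.nonneg_iff_isPositive _).1 h).re_inner_nonneg_right φ
  have sq : ∀ y : X, ⟪y, y⟫_ℂ = ((‖y‖ ^ 2 : ℝ) : ℂ) := fun y => by
    rw [inner_self_eq_norm_sq_to_K]; simp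
  have e₁ : ⟪φ, (Z * Z) φ⟫_ℂ = ((‖Z φ‖ ^ 2 : ℝ) : ℂ) := by
    rw [mul_apply_eq_comp, ← sq]
    exact (hZ.isSymmetric φ (Z φ)).symm
  have e₂ : ⟪φ, (star W * W) φ⟫_ℂ = ((‖W φ‖ ^ 2 : ℝ) : ℂ) := by
    rw [mul_apply_eq_comp, ContinuousLinearMap.star_eq_adjoint,
      ContinuousLinearMap.adjoint_inner_right, sq]
  rw [sub_apply, sub_apply, smul_apply, smul_apply, one_apply_eq_self, inner_sub_right,
    inner_sub_right, inner_smul_right, inner_smul_right, e₁, e₂, sq] at this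
  simp only [← Complex.ofReal_mul, ← Complex.ofReal_sub, RCLike.re_to_complex,
    Complex.ofReal_re] at this
  linarith

/-- The contribution of one outcome of the guessed measurement: with `e ^ 2` its effect, `a` the
other observable of Alice and `B₀`, `B₁` those of Bob. -/
theorem sector_bound {e f a B₀ B₁ : X →L[ℂ] X} (he : IsSelfAdjoint e) (hf : IsSelfAdjoint f)
    (hef : e * e + f * f = 1) (ha : 0 ≤ 1 + a) (ha' : 0 ≤ 1 - a)
    (hB₀ : 0 ≤ 1 + B₀) (hB₀' : 0 ≤ 1 - B₀) (hB₁ : 0 ≤ 1 + B₁) (hB₁' : 0 ≤ 1 - B₁)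
    (he₀ : Commute B₀ e) (he₁ : Commute B₁ e) (hf₀ : Commute B₀ f) (hf₁ : Commute B₁ f)
    (ha₀ : Commute B₀ a) (ha₁ : Commute B₁ a) {r s : ℝ} (hs : 0 ≤ s) (hsr : s ≤ r) (φ : X) :
    ‖((r : ℂ) • (B₀ + B₁) + (s : ℂ) • (e * a * e * (B₀ - B₁))) φ‖ ^ 2
      + r ^ 2 * ‖(f * a * e * (B₀ - B₁)) φ‖ ^ 2 ≤ 4 * r ^ 2 * ‖φ‖ ^ 2 := by
  have hr : 0 ≤ r := hs.trans hsr
  have sa := isSelfAdjoint_of_one_add_nonneg ha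
  have sB₀ := isSelfAdjoint_of_one_add_nonneg hB₀
  have sB₁ := isSelfAdjoint_of_one_add_nonneg hB₁
  have sx : IsSelfAdjoint (e * a * e) := by
    rw [IsSelfAdjoint, star_mul, star_mul, he.star_eq, sa.star_eq, mul_assoc]
  have cx₀ : Commute B₀ (e * a * e) := (he₀.mul_right ha₀).mul_right he₀
  have cx₁ : Commute B₁ (e * a * e) := (he₁.mul_right ha₁).mul_right he₁
  have sD : IsSelfAdjoint (B₀ - B₁) := sB₀.sub sB₁
  have sxD : IsSelfAdjoint (e * a * e * (B₀ - B₁)) :=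
    (sx.commute_iff sD).1 (cx₀.symm.sub_right cx₁.symm)
  have hreal : ∀ c : ℝ, IsSelfAdjoint (c : ℂ) := fun c => Complex.conj_ofReal c
  have hx := one_add_conjugate_nonneg he hf hef ha
  have hx' : 0 ≤ 1 + -(e * a * e) := by
    have h := one_add_conjugate_nonneg he hf hef (a := -a) (by rwa [← sub_eq_add_neg])
    rwa [mul_neg, neg_mul] at h
  have w₁ := weighted_nonneg hx hB₀ hB₀' cx₀ hs hsr
  have w₂ := weighted_nonneg hx' hB₁ hB₁' cx₁.neg_right hs hsr
  rw [smul_neg, ← sub_eq_add_neg] at w₂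
  have aa := one_sub_mul_self_nonneg ha ha'
  have hrs : 0 ≤ r ^ 2 - s ^ 2 := by nlinarith
  refine norm_sq_add_norm_sq_le
    (((hreal r).smul (sB₀.add sB₁)).add ((hreal s).smul sxD)) ?_ φ
  have sW : star (f * a * e * (B₀ - B₁)) = (B₀ - B₁) * (e * a * f) := by
    rw [star_mul, star_mul, star_mul, hf.star_eq, he.star_eq, sa.star_eq, sD.star_eq, mul_assoc]
  have id := sector_identity hef he₀ he₁ hf₀ hf₁ ha₀ ha₁ (r : ℂ) (s : ℂ)
  -- The hypothesis `s ≤ r` enters twice: in the positivity of `r ± s x`, hidden in `w₁` and `w₂`,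
  -- and in that of `r² - s²`.
  have pos := add_nonneg (add_nonneg (add_nonneg (add_nonneg
    (real_smul_nonneg w₁ (mul_nonneg zero_le_two hr))
    (real_smul_nonneg w₂ (mul_nonneg zero_le_two hr)))
    (real_smul_nonneg (conjugate_nonneg sD hf.mul_self_nonneg) (sq_nonneg r)))
    (real_smul_nonneg (conjugate_nonneg sD (conjugate_nonneg he aa)) (sq_nonneg r)))
    (real_smul_nonneg sxD.mul_self_nonneg hrs)
  push_cast at pos ⊢
  rw [sW]
  exact id ▸ pos

/-- Here `A`, `B` are the norms of the two pieces, `N₁`, `N₂` the diagonal norms, and `t` the cross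
term. A nonpositive `t` can be dropped. Otherwise the normalized `τ = t / (A B)` limits both
diagonal norms by the same factor `√(4 - τ²)`. -/
theorem le_of_sectors {A B N₁ N₂ k₁ k₂ t v r s : ℝ} (hA : 0 ≤ A) (hB : 0 ≤ B) (hr : 0 < r)
    (hs : 0 ≤ s)
    (hv : v ≤ A * N₁ + B * N₂ + 2 * s * t) (ht₁ : t ≤ B * k₁) (ht₂ : t ≤ A * k₂)
    (h₁ : N₁ ^ 2 + r ^ 2 * k₁ ^ 2 ≤ 4 * r ^ 2 * A ^ 2)
    (h₂ : N₂ ^ 2 + r ^ 2 * k₂ ^ 2 ≤ 4 * r ^ 2 * B ^ 2) :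
    v ≤ 2 * √(r ^ 2 * (A ^ 2 + B ^ 2) ^ 2 + 4 * s ^ 2 * (A ^ 2 * B ^ 2)) := by
  rcases le_or_gt t 0 with ht | ht
  · have hN₁ : N₁ ≤ 2 * r * A := by
      refine abs_le_of_sq_le_sq' ?_ (by positivity) |>.2
      linarith [mul_nonneg (sq_nonneg r) (sq_nonneg k₁)]
    have hN₂ : N₂ ≤ 2 * r * B := by
      refine abs_le_of_sq_le_sq' ?_ (by positivity) |>.2
      linarith [mul_nonneg (sq_nonneg r) (sq_nonneg k₂)]
    have : r * (A ^ 2 + B ^ 2) ≤ √(r ^ 2 * (A ^ 2 + B ^ 2) ^ 2 + 4 * s ^ 2 * (A ^ 2 * B ^ 2)) := by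
      refine Real.le_sqrt_of_sq_le ?_
      rw [mul_pow]
      exact le_add_of_nonneg_right (by positivity)
    linarith [mul_le_mul_of_nonneg_left hN₁ hA, mul_le_mul_of_nonneg_left hN₂ hB,
      mul_nonneg hs (neg_nonneg.2 ht)]
  have hA' : 0 < A := by
    rcases hA.eq_or_lt with h | h
    · rw [← h] at ht₂; linarith
    · exact h
  have hB' : 0 < B := by
    rcases hB.eq_or_lt with h | h
    · rw [← h] at ht₁; linarith
    · exact h
  set τ := t / (A * B) with hτ
  have hτ0 : 0 < τ := by positivity
  have htτ : t = A * B * τ := by rw [hτ]; field_simp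
  have hkτ₁ : A * τ ≤ k₁ := by
    rw [htτ] at ht₁
    exact le_of_mul_le_mul_left (by linarith) hB'
  have hkτ₂ : B * τ ≤ k₂ := by
    rw [htτ] at ht₂
    exact le_of_mul_le_mul_left (by linarith) hA'
  have sq₁ : N₁ ^ 2 ≤ (r * A) ^ 2 * (4 - τ ^ 2) := by
    have : (A * τ) ^ 2 ≤ k₁ ^ 2 := by gcongr
    linarith [mul_le_mul_of_nonneg_left this (sq_nonneg r)]
  have sq₂ : N₂ ^ 2 ≤ (r * B) ^ 2 * (4 - τ ^ 2) := by
    have : (B * τ) ^ 2 ≤ k₂ ^ 2 := by gcongr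
    linarith [mul_le_mul_of_nonneg_left this (sq_nonneg r)]
  have hu0 : 0 ≤ 4 - τ ^ 2 :=
    nonneg_of_mul_nonneg_right ((sq_nonneg _).trans sq₁) (by positivity)
  set u := √(4 - τ ^ 2) with hu
  have husq : u ^ 2 = 4 - τ ^ 2 := Real.sq_sqrt hu0
  have hu' : 0 ≤ u := Real.sqrt_nonneg _
  have b₁ : N₁ ≤ r * A * u :=
    abs_le_of_sq_le_sq' (by rw [mul_pow, husq]; exact sq₁) (by positivity) |>.2
  have b₂ : N₂ ≤ r * B * u :=
    abs_le_of_sq_le_sq' (by rw [mul_pow, husq]; exact sq₂) (by positivity) |>.2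
  set R := √(r ^ 2 * (A ^ 2 + B ^ 2) ^ 2 + 4 * s ^ 2 * (A ^ 2 * B ^ 2)) with hR
  have hRsq : R ^ 2 = r ^ 2 * (A ^ 2 + B ^ 2) ^ 2 + 4 * s ^ 2 * (A ^ 2 * B ^ 2) :=
    Real.sq_sqrt (by positivity)
  -- Cauchy–Schwarz against the vector `(u, τ)`, whose length is 2.
  have cs : r * (A ^ 2 + B ^ 2) * u + 2 * s * (A * B) * τ ≤ 2 * R := by
    refine abs_le_of_sq_le_sq' ?_ (by positivity) |>.2
    have : (2 * R) ^ 2 = R ^ 2 * (u ^ 2 + τ ^ 2) := by rw [husq]; ring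
    rw [this, hRsq]
    linarith [sq_nonneg (r * (A ^ 2 + B ^ 2) * τ - 2 * s * (A * B) * u)]
  have c₁ := mul_le_mul_of_nonneg_left b₁ hA
  have c₂ := mul_le_mul_of_nonneg_left b₂ hB
  rw [htτ] at hv
  linarith

/-- The biased CHSH operator in a vector state `ψ`, where `e ^ 2` and `f ^ 2` are the effects of
the guessed measurement. -/
theorem vector_bound {e f a B₀ B₁ : X →L[ℂ] X} (he : IsSelfAdjoint e) (hf : IsSelfAdjoint f)
    (hef : e * e + f * f = 1) (ha : 0 ≤ 1 + a) (ha' : 0 ≤ 1 - a)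
    (hB₀ : 0 ≤ 1 + B₀) (hB₀' : 0 ≤ 1 - B₀) (hB₁ : 0 ≤ 1 + B₁) (hB₁' : 0 ≤ 1 - B₁)
    (he₀ : Commute B₀ e) (he₁ : Commute B₁ e) (hf₀ : Commute B₀ f) (hf₁ : Commute B₁ f)
    (ha₀ : Commute B₀ a) (ha₁ : Commute B₁ a) {r s : ℝ} (hr : 0 < r) (hs : 0 ≤ s) (hsr : s ≤ r)
    (ψ : X) :
    (⟪ψ, ((r : ℂ) • ((e * e - f * f) * (B₀ + B₁)) + (s : ℂ) • (a * (B₀ - B₁))) ψ⟫_ℂ).re ≤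
      2 * √(r ^ 2 * (‖e ψ‖ ^ 2 + ‖f ψ‖ ^ 2) ^ 2 + 4 * s ^ 2 * (‖e ψ‖ ^ 2 * ‖f ψ‖ ^ 2)) := by
  have sa := isSelfAdjoint_of_one_add_nonneg ha
  have sD : IsSelfAdjoint (B₀ - B₁) :=
    (isSelfAdjoint_of_one_add_nonneg hB₀).sub (isSelfAdjoint_of_one_add_nonneg hB₁)
  have hfe : f * f + e * e = 1 := by rw [add_comm, hef]
  have h₁ := sector_bound he hf hef ha ha' hB₀ hB₀' hB₁ hB₁' he₀ he₁ hf₀ hf₁ ha₀ ha₁ hs hsr (e ψ)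
  -- The guessed observable `e² - f²` changes sign on the second piece. The substitution `(B₀, B₁) ↦
  -- (-B₁, -B₀)` negates `B₀ + B₁` while fixing `B₀ - B₁`.
  have h₂ := sector_bound (B₀ := -B₁) (B₁ := -B₀) hf he hfe ha ha'
    (by rwa [← sub_eq_add_neg]) (by rwa [sub_neg_eq_add]) (by rwa [← sub_eq_add_neg])
    (by rwa [sub_neg_eq_add]) hf₁.neg_left hf₀.neg_left he₁.neg_left he₀.neg_left ha₁.neg_left
    ha₀.neg_left hs hsr (f ψ)
  have hD : -B₁ - -B₀ = B₀ - B₁ := by abel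
  rw [hD] at h₂
  set D := B₀ - B₁ with hDdef
  have cDe : Commute D e := he₀.sub_left he₁
  have cDf : Commute D f := hf₀.sub_left hf₁
  have cDa : Commute D a := ha₀.sub_left ha₁
  set Z₁ := (r : ℂ) • (B₀ + B₁) + (s : ℂ) • (e * a * e * D) with hZ₁
  set Z₂ := (r : ℂ) • (-B₁ + -B₀) + (s : ℂ) • (f * a * f * D) with hZ₂
  have move : ∀ {u : X →L[ℂ] X}, IsSelfAdjoint u → ∀ T y, ⟪u ψ, (T : X →L[ℂ] X) y⟫_ℂ =
      ⟪ψ, (u * T) y⟫_ℂ := fun hu T y => hu.isSymmetric ψ (T y)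
  -- This is `a = (e² + f²) a (e² + f²)` multiplied out; the two mixed terms are complex conjugates
  -- of each other.
  have expand : (⟪ψ, ((r : ℂ) • ((e * e - f * f) * (B₀ + B₁)) + (s : ℂ) • (a * D)) ψ⟫_ℂ)
      = ⟪e ψ, Z₁ (e ψ)⟫_ℂ + ⟪f ψ, Z₂ (f ψ)⟫_ℂ
        + s * (⟪f ψ, (f * a * e * D) (e ψ)⟫_ℂ + ⟪e ψ, (e * a * f * D) (f ψ)⟫_ℂ) := by
    rw [move he, move hf, move he, move hf, ← mul_apply_eq_comp, ← mul_apply_eq_comp,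
      ← mul_apply_eq_comp, ← mul_apply_eq_comp, ← inner_add_right, ← inner_add_right,
      ← inner_smul_right, ← inner_add_right]
    simp only [← add_apply, ← smul_apply]
    congr 2
    have hff : f * f = 1 - e * e := by rw [← hef]; abel
    have hff' : ∀ z, f * (f * z) = z - e * (e * z) := fun z => by
      rw [← mul_assoc, hff, sub_mul, one_mul, mul_assoc]
    simp only [hZ₁, hZ₂, hDdef, mul_add, add_mul, mul_sub, sub_mul, smul_mul_assoc, mul_smul_comm,
      mul_neg, neg_mul, mul_assoc, he₀.eq, he₁.eq, hf₀.eq, hf₁.eq, hff, hff', one_mul]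
    module
  have conj : ⟪e ψ, (e * a * f * D) (f ψ)⟫_ℂ
      = (starRingEnd ℂ) ⟪f ψ, (f * a * e * D) (e ψ)⟫_ℂ := by
    have hst : star (f * a * e * D) = e * a * f * D := by
      rw [star_mul, star_mul, star_mul, hf.star_eq, he.star_eq, sa.star_eq, sD.star_eq,
        ← mul_assoc, ← mul_assoc, (((cDe.mul_right cDa).mul_right cDf).eq.symm)]
      simp only [mul_assoc]
    rw [inner_conj_symm, ← hst, ContinuousLinearMap.star_eq_adjoint,
      ContinuousLinearMap.adjoint_inner_right]
  have ht : (⟪e ψ, (e * a * f * D) (f ψ)⟫_ℂ).re = (⟪f ψ, (f * a * e * D) (e ψ)⟫_ℂ).re := by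
    rw [conj, Complex.conj_re]
  refine le_of_sectors (norm_nonneg _) (norm_nonneg _) hr hs
    (t := (⟪f ψ, (f * a * e * D) (e ψ)⟫_ℂ).re) ?_ (re_inner_le_norm_mul _ _ _)
    (ht ▸ re_inner_le_norm_mul _ _ _) h₁ h₂
  rw [expand, Complex.add_re, Complex.add_re, Complex.re_ofReal_mul, Complex.add_re, ht]
  have i₁ := re_inner_le_norm_mul Z₁ (e ψ) (e ψ)
  have i₂ := re_inner_le_norm_mul Z₂ (f ψ) (f ψ)
  linarith

end SectorBound

/-! ### From the operator bound to the score -/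

section VectorBehavior

variable {X : Type} [NormedAddCommGroup X] [InnerProductSpace ℂ X]

/-- The (unnormalized) table of joint expectations in a vector state. -/
def vectorBehavior (M N : Fin 2 → Fin 2 → (X →L[ℂ] X)) (ψ : X) : Behavior :=
  fun a b x y => (⟪ψ, (M x a * N y b) ψ⟫_ℂ).re

variable [CompleteSpace X] {M N : Fin 2 → Fin 2 → (X →L[ℂ] X)}

theorem vectorBehavior_nonneg (h : CommutingMeasurements M N) (ψ : X) (a b x y : Fin 2) :
    0 ≤ vectorBehavior M N ψ a b x y := by
  have := (h.commute x a y b).mul_nonneg (h.left_nonneg x a) (h.right_nonneg y b)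
  exact ((ContinuousLinearMap.nonneg_iff_isPositive _).1 this).re_inner_nonneg_right ψ

theorem marginal_vectorBehavior (h : CommutingMeasurements M N) (ψ : X) (a x : Fin 2) :
    marginal (vectorBehavior M N ψ) a x = (⟪ψ, M x a ψ⟫_ℂ).re := by
  rw [marginal, Fin.sum_univ_two, vectorBehavior, vectorBehavior, ← Complex.add_re,
    ← inner_add_right, ← add_apply, ← mul_add, h.right_sum, mul_one]

theorem sum_vectorBehavior (h : CommutingMeasurements M N) (ψ : X) (x y : Fin 2) :
    ∑ a, ∑ b, vectorBehavior M N ψ a b x y = ‖ψ‖ ^ 2 := by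
  have : ∀ a, ∑ b, vectorBehavior M N ψ a b x y = (⟪ψ, M x a ψ⟫_ℂ).re := fun a => by
    rw [Fin.sum_univ_two, vectorBehavior, vectorBehavior, ← Complex.add_re,
      ← inner_add_right, ← add_apply, ← mul_add, h.right_sum, mul_one]
  rw [Fin.sum_univ_two, this, this, ← Complex.add_re, ← inner_add_right, ← add_apply, h.left_sum,
    one_apply_eq_self, inner_self_eq_norm_sq_to_K]
  simp [← Complex.ofReal_pow]

theorem one_add_sub_nonneg {S T : X →L[ℂ] X} (hS : 0 ≤ S) (h : S + T = 1) : 0 ≤ 1 + (S - T) := by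
  have e : 1 + (S - T) = S + S := by rw [← h]; abel
  rw [e]; exact add_nonneg hS hS

theorem one_sub_sub_nonneg {S T : X →L[ℂ] X} (hT : 0 ≤ T) (h : S + T = 1) : 0 ≤ 1 - (S - T) := by
  have e : 1 - (S - T) = T + T := by rw [← h]; abel
  rw [e]; exact add_nonneg hT hT

theorem norm_sqrt_apply_sq {T : X →L[ℂ] X} (hT : 0 ≤ T) (ψ : X) :
    ‖CFC.sqrt T ψ‖ ^ 2 = (⟪ψ, T ψ⟫_ℂ).re := by
  have h : ⟪CFC.sqrt T ψ, CFC.sqrt T ψ⟫_ℂ = ⟪ψ, (CFC.sqrt T * CFC.sqrt T) ψ⟫_ℂ :=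
    (CFC.sqrt_nonneg T).isSelfAdjoint.isSymmetric ψ (CFC.sqrt T ψ)
  rw [CFC.sqrt_mul_sqrt_self T hT, inner_self_eq_norm_sq_to_K] at h
  rw [← h]
  simp [← Complex.ofReal_pow]

/-- The score of a vector state in terms of the marginal of the guessed measurement. -/
theorem score_vectorBehavior_le (h : CommutingMeasurements M N) (ψ : X) (xs : Fin 2) {r : ℝ}
    (hr : 1 / 2 ≤ r) (hr' : r < 1) :
    score (biasedInputs r xs) (vectorBehavior M N ψ) ≤
      4 * √(r ^ 2 * (marginal (vectorBehavior M N ψ) 0 xs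
          + marginal (vectorBehavior M N ψ) 1 xs) ^ 2
        + 4 * (1 - r) ^ 2 * (marginal (vectorBehavior M N ψ) 0 xs
          * marginal (vectorBehavior M N ψ) 1 xs)) := by
  have hroot : ∀ a, CFC.sqrt (M xs a) * CFC.sqrt (M xs a) = M xs a := fun a =>
    CFC.sqrt_mul_sqrt_self (M xs a) (h.left_nonneg xs a)
  have croot : ∀ a y b, Commute (N y b) (CFC.sqrt (M xs a)) := fun a y b =>
    ((h.commute xs a y b).cfcₙ_nnreal _).symm
  have cobs : ∀ x y b, Commute (N y b) (M x 0 - M x 1) := fun x y b =>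
    (h.commute x 0 y b).symm.sub_right (h.commute x 1 y b).symm
  have bN := fun y => one_add_sub_nonneg (h.right_nonneg y 0) (h.right_sum y)
  have bN' := fun y => one_sub_sub_nonneg (h.right_nonneg y 1) (h.right_sum y)
  have sN : ∀ {y : Fin 2} {u : X →L[ℂ] X}, (∀ b, Commute (N y b) u) →
      Commute (N y 0 - N y 1) u := fun hu => (hu 0).sub_left (hu 1)
  simp only [marginal_vectorBehavior h, ← norm_sqrt_apply_sq (h.left_nonneg _ _)]
  have main : ∀ x' B₁, 0 ≤ 1 + B₁ → 0 ≤ 1 - B₁ → (∀ a, Commute B₁ (CFC.sqrt (M xs a))) →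
      Commute B₁ (M x' 0 - M x' 1) → _ := fun x' B₁ hB hB' hBs hBa =>
    vector_bound (B₀ := N 0 0 - N 0 1) (B₁ := B₁) (a := M x' 0 - M x' 1)
      (CFC.sqrt_nonneg (M xs 0)).isSelfAdjoint (CFC.sqrt_nonneg (M xs 1)).isSelfAdjoint
      (by rw [hroot, hroot, h.left_sum]) (one_add_sub_nonneg (h.left_nonneg x' 0) (h.left_sum x'))
      (one_sub_sub_nonneg (h.left_nonneg x' 1) (h.left_sum x')) (bN 0) (bN' 0) hB hB'
      (sN (croot 0 0)) (hBs 0) (sN (croot 1 0)) (hBs 1) (sN (cobs x' 0)) hBa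
      (r := r) (s := 1 - r) (by linarith) (by linarith) (by linarith) ψ
  simp only [hroot] at main
  rcases Fin.eq_zero_or_eq_succ xs with rfl | ⟨i, rfl⟩
  · have := main 1 (N 1 0 - N 1 1) (bN 1) (bN' 1) (fun a => sN (croot a 1)) (sN (cobs 1 1))
    simp only [mul_add, mul_sub, sub_mul, add_apply, sub_apply, smul_apply, inner_add_right,
      inner_sub_right, inner_smul_right, smul_add, smul_sub, Complex.add_re, Complex.sub_re,
      Complex.re_ofReal_mul] at this
    simp only [score, biasedInputs, vectorBehavior, Fin.sum_univ_two]
    norm_num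
    norm_num at this
    linarith
  · obtain rfl : i = 0 := Subsingleton.elim _ _
    -- For guessed input 1, Alice's inputs exchange roles, and flipping Bob's outcome for `y = 1`
    -- restores the CHSH signs.
    have := main 0 (-(N 1 0 - N 1 1)) (by rw [← sub_eq_add_neg]; exact bN' 1)
      (by rw [sub_neg_eq_add]; exact bN 1) (fun a => (sN (croot a 1)).neg_left)
      (sN (cobs 0 1)).neg_left
    simp only [mul_add, mul_sub, sub_mul, mul_neg, add_apply, sub_apply, smul_apply,
      neg_apply, inner_add_right, inner_neg_right, smul_neg,
      inner_sub_right, inner_smul_right, smul_add, smul_sub, Complex.add_re, Complex.sub_re,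
      Complex.neg_re, Complex.re_ofReal_mul] at this
    simp only [score, biasedInputs, vectorBehavior, Fin.sum_univ_two]
    norm_num
    norm_num at this
    linarith

end VectorBehavior

/-! ### Tilted Bell inequalities and the upper bound -/

section Sums

variable {ι : Type} {p : ι → Behavior} {P : Behavior}

theorem hasSum_score (h : ∀ a b x y, HasSum (fun j => p j a b x y) (P a b x y))
    (π : Fin 2 → Fin 2 → ℝ) : HasSum (fun j => score π (p j)) (score π P) :=
  (hasSum_sum fun a _ => hasSum_sum fun b _ => hasSum_sum fun x _ => hasSum_sum fun y _ =>
    ((h a b x y).mul_left _).mul_right _).mul_left _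

theorem hasSum_marginal (h : ∀ a b x y, HasSum (fun j => p j a b x y) (P a b x y)) (a x : Fin 2) :
    HasSum (fun j => marginal (p j) a x) (marginal P a x) :=
  hasSum_sum fun b _ => h a b x 0

theorem score_smul (π : Fin 2 → Fin 2 → ℝ) (q : ℝ) (P : Behavior) :
    score π (fun a b x y => q * P a b x y) = q * score π P := by
  simp only [score, Fin.sum_univ_two]
  ring

end Sums

/-- The point `(w, s(p - q))`, with `w` the square root in `hv`, has length `√(r² + s²)(p + q)`, so
this is Cauchy–Schwarz with `(α, β)`. Both sides are linear in `(v, p, q)`, which is what allows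
summation. -/
theorem linear_le_of_le_sqrt {r s v p q α β : ℝ} (hα : 0 ≤ α) (hp : 0 ≤ p) (hq : 0 ≤ q)
    (hv : v ≤ √(r ^ 2 * (p + q) ^ 2 + 4 * s ^ 2 * (p * q))) :
    α * v + β * (s * (p - q)) ≤ √(α ^ 2 + β ^ 2) * √(r ^ 2 + s ^ 2) * (p + q) := by
  set w := √(r ^ 2 * (p + q) ^ 2 + 4 * s ^ 2 * (p * q)) with hw
  have hwsq : w ^ 2 = r ^ 2 * (p + q) ^ 2 + 4 * s ^ 2 * (p * q) := Real.sq_sqrt (by positivity)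
  refine (add_le_add_left (mul_le_mul_of_nonneg_left hv hα) _).trans ?_
  refine abs_le_of_sq_le_sq' ?_ (by positivity) |>.2
  rw [mul_pow, mul_pow, Real.sq_sqrt (by positivity), Real.sq_sqrt (by positivity)]
  have : (r ^ 2 + s ^ 2) * (p + q) ^ 2 = w ^ 2 + (s * (p - q)) ^ 2 := by rw [hwsq]; ring
  rw [mul_assoc, this]
  linarith [sq_nonneg (α * (s * (p - q)) - β * w)]

theorem IsQuantum.nonneg {P : Behavior} (hP : IsQuantum P) (a b x y : Fin 2) :
    0 ≤ P a b x y := by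
  obtain ⟨X, _, _, _, M, N, ι, ψ, hMN, -, hsum⟩ := hP.exists_commuting
  exact (hsum a b x y).nonneg fun j => vectorBehavior_nonneg hMN (ψ j) a b x y

theorem IsQuantum.sum_eq_one {P : Behavior} (hP : IsQuantum P) (x y : Fin 2) :
    ∑ a, ∑ b, P a b x y = 1 := by
  obtain ⟨X, _, _, _, M, N, ι, ψ, hMN, hψ, hsum⟩ := hP.exists_commuting
  refine HasSum.unique (hasSum_sum fun a _ => hasSum_sum fun b _ => hsum a b x y) ?_
  convert hψ using 2 with j
  exact sum_vectorBehavior hMN (ψ j) x y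

theorem IsQuantum.le_one {P : Behavior} (hP : IsQuantum P) (a b x y : Fin 2) :
    P a b x y ≤ 1 := by
  rw [← hP.sum_eq_one x y]
  refine (Finset.single_le_sum (f := fun b => P a b x y) (fun b _ => hP.nonneg a b x y)
    (Finset.mem_univ b)).trans ?_
  exact Finset.single_le_sum (f := fun a => ∑ b, P a b x y)
    (fun a _ => Finset.sum_nonneg fun b _ => hP.nonneg a b x y) (Finset.mem_univ a)

theorem IsQuantum.marginal_add {P : Behavior} (hP : IsQuantum P) (x : Fin 2) :
    marginal P 0 x + marginal P 1 x = 1 := by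
  rw [← hP.sum_eq_one x 0, Fin.sum_univ_two]; rfl

theorem IsQuantum.marginal_nonneg {P : Behavior} (hP : IsQuantum P) (a x : Fin 2) :
    0 ≤ marginal P a x := Finset.sum_nonneg fun b _ => hP.nonneg a b x 0

/-- The tilted Bell inequalities bounding score and predictability of a quantum behavior. -/
theorem IsQuantum.tilted_le {P : Behavior} (hP : IsQuantum P) (xs : Fin 2) {r α : ℝ}
    (hr : 1 / 2 ≤ r) (hr' : r < 1) (hα : 0 ≤ α) (β : ℝ) :
    α * (score (biasedInputs r xs) P / 4)
        + β * ((1 - r) * (marginal P 0 xs - marginal P 1 xs)) ≤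
      √(α ^ 2 + β ^ 2) * √(r ^ 2 + (1 - r) ^ 2) := by
  obtain ⟨X, _, _, _, M, N, ι, ψ, hMN, hψ, hsum⟩ := hP.exists_commuting
  have hm := hasSum_marginal (p := fun j => vectorBehavior M N (ψ j)) hsum
  have hs := hasSum_score (p := fun j => vectorBehavior M N (ψ j)) hsum (biasedInputs r xs)
  have hl := ((hs.div_const 4).mul_left α).add
    ((((hm 0 xs).sub (hm 1 xs)).mul_left (1 - r)).mul_left β)
  have hR := hψ.mul_left (√(α ^ 2 + β ^ 2) * √(r ^ 2 + (1 - r) ^ 2))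
  rw [mul_one] at hR
  refine hasSum_le (fun j => ?_) hl hR
  have hnn : ∀ a, 0 ≤ marginal (vectorBehavior M N (ψ j)) a xs := fun a =>
    Finset.sum_nonneg fun b _ => vectorBehavior_nonneg hMN (ψ j) a b xs 0
  have hn : ‖ψ j‖ ^ 2 = marginal (vectorBehavior M N (ψ j)) 0 xs
      + marginal (vectorBehavior M N (ψ j)) 1 xs := by
    rw [← sum_vectorBehavior hMN (ψ j) xs 0, Fin.sum_univ_two]; rfl
  rw [hn]
  refine linear_le_of_le_sqrt hα (hnn 0) (hnn 1) ?_
  linarith [score_vectorBehavior_le hMN (ψ j) xs hr hr']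

theorem IsQuantum.tilted_abs_le {P : Behavior} (hP : IsQuantum P) (xs : Fin 2) {r α β : ℝ}
    (hr : 1 / 2 ≤ r) (hr' : r < 1) (hα : 0 ≤ α) :
    α * (score (biasedInputs r xs) P / 4)
        + β * ((1 - r) * |marginal P 0 xs - marginal P 1 xs|) ≤
      √(α ^ 2 + β ^ 2) * √(r ^ 2 + (1 - r) ^ 2) := by
  rcases abs_choice (marginal P 0 xs - marginal P 1 xs) with h | h <;> rw [h]
  · exact hP.tilted_le xs hr hr' hα β
  · have := hP.tilted_le xs hr hr' hα (-β)
    rw [neg_sq] at this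
    linarith

theorem max_eq_of_add_eq_one {a b : ℝ} (h : a + b = 1) : max a b = 1 / 2 * (1 + |a - b|) := by
  rcases le_total a b with hab | hab
  · rw [max_eq_right hab, abs_of_nonpos (by linarith)]; linarith
  · rw [max_eq_left hab, abs_of_nonneg (by linarith)]; linarith

theorem guessingValues_le {xs : Fin 2} {r S g : ℝ} (hr : 1 / 2 ≤ r) (hr' : r < 1)
    (hS : 4 * r ≤ S)
    (hg : g ∈ guessingValues (score (biasedInputs r xs)) xs S) : g ≤ guessFormula r S := by
  obtain ⟨Λ, q, P, hq, hq1, hP, hV, rfl⟩ := hg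
  -- Guarantees that the `tsum`s over Eve's variable are genuine sums rather than the default value
  -- 0.
  have bounded : ∀ u : Λ → ℝ, (∀ l, 0 ≤ u l) → (∀ l, u l ≤ 1) →
      Summable fun l => q l * u l := fun u h0 h1 =>
    Summable.of_nonneg_of_le (fun l => mul_nonneg (hq l) (h0 l))
      (fun l => mul_le_of_le_one_right (hq l) (h1 l)) hq1.summable
  have havg : ∀ a b x y, HasSum (fun l => q l * P l a b x y) (average q P a b x y) :=
    fun a b x y => (bounded (fun l => P l a b x y) (fun l => (hP l).nonneg a b x y)
      fun l => (hP l).le_one a b x y).hasSum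
  have hscore := hasSum_score (p := fun l a b x y => q l * P l a b x y) havg (biasedInputs r xs)
  simp only [score_smul] at hscore
  rw [hV] at hscore
  set m : Λ → ℝ := fun l => |marginal (P l) 0 xs - marginal (P l) 1 xs| with hm
  have hm1 : ∀ l, m l ≤ 1 := fun l => by
    have h0 := (hP l).marginal_nonneg 0 xs
    have h1 := (hP l).marginal_nonneg 1 xs
    have := (hP l).marginal_add xs
    exact abs_le.2 ⟨by linarith, by linarith⟩
  have hmsum := (bounded m (fun l => abs_nonneg _) hm1).hasSum
  set μ := ∑' l, q l * m l with hμ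
  have hμ0 : 0 ≤ μ := tsum_nonneg fun l => mul_nonneg (hq l) (abs_nonneg _)
  have hguess : ∑' l, q l * max (marginal (P l) 0 xs) (marginal (P l) 1 xs) = 1 / 2 * (1 + μ) := by
    refine HasSum.tsum_eq ?_
    convert! (hq1.add hmsum).mul_left (1 / 2) using 1
    funext l
    rw [max_eq_of_add_eq_one ((hP l).marginal_add xs)]
    ring
  have hS0 : 0 ≤ S / 4 := by linarith
  -- The tilt `(α, β)` is the averaged point `(S/4, (1 - r) μ)` itself, so the left side becomes its
  -- squared length `n`, and cancelling `√n` gives `n ≤ r² + (1 - r)²`.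
  have htilt : S / 4 * (S / 4) + (1 - r) * μ * ((1 - r) * μ) ≤
      √((S / 4) ^ 2 + ((1 - r) * μ) ^ 2) * √(r ^ 2 + (1 - r) ^ 2) := by
    have hl := ((hscore.div_const 4).mul_left (S / 4)).add
      ((hmsum.mul_left (1 - r)).mul_left ((1 - r) * μ))
    have hR := hq1.mul_right (√((S / 4) ^ 2 + ((1 - r) * μ) ^ 2) * √(r ^ 2 + (1 - r) ^ 2))
    rw [one_mul] at hR
    refine hasSum_le (fun l => ?_) hl hR
    have := mul_le_mul_of_nonneg_left
      ((hP l).tilted_abs_le xs (β := (1 - r) * μ) hr hr' hS0) (hq l)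
    linarith
  set n := (S / 4) ^ 2 + ((1 - r) * μ) ^ 2 with hn
  have hn0 : 0 ≤ n := by positivity
  have hnle : n ≤ r ^ 2 + (1 - r) ^ 2 := by
    have h1 : √n * √n ≤ √n * √(r ^ 2 + (1 - r) ^ 2) := by
      rw [Real.mul_self_sqrt hn0]
      linarith
    rcases hn0.eq_or_lt with h | h
    · rw [← h]; positivity
    · exact (Real.sqrt_le_sqrt_iff (by positivity)).1
        (le_of_mul_le_mul_left h1 (Real.sqrt_pos.2 h))
  have hpos : 0 < 1 - r := by linarith
  rw [hguess, guessFormula]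
  gcongr
  refine Real.le_sqrt_of_sq_le ?_
  rw [le_sub_iff_add_le, one_div_mul_eq_div, ← le_sub_iff_add_le', div_le_iff₀ (by positivity)]
  linarith

/-! ### The optimal two-qubit strategy -/

/-- The real orthonormal basis of the qubit space rotated by the angle `θ`. -/
def qubit (θ : ℝ) (a : Fin 2) : Fin 2 → ℝ :=
  ![![Real.cos θ, Real.sin θ], ![-Real.sin θ, Real.cos θ]] a

/-- The rotated basis as vectors of the qubit Hilbert space. -/
def qubitVector (θ : ℝ) (a : Fin 2) : EuclideanSpace ℂ (Fin 2) :=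
  WithLp.toLp 2 fun i => (qubit θ a i : ℂ)

/-- The projective measurement in the rotated basis. -/
def qubitMeasurement (θ : ℝ) (a : Fin 2) :
    EuclideanSpace ℂ (Fin 2) →L[ℂ] EuclideanSpace ℂ (Fin 2) :=
  InnerProductSpace.rankOne ℂ (qubitVector θ a) (qubitVector θ a)

theorem isPOVM_qubitMeasurement (θ : ℝ) : IsPOVM (qubitMeasurement θ) := by
  refine ⟨fun a => InnerProductSpace.isPositive_rankOne_self _, ?_⟩
  have h := Complex.cos_sq_add_sin_sq (θ : ℂ)
  ext v i
  fin_cases i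
  · simp [qubitMeasurement, qubitVector, qubit, Fin.sum_univ_two, PiLp.inner_apply]
    linear_combination (v 0) * h
  · simp [qubitMeasurement, qubitVector, qubit, Fin.sum_univ_two, PiLp.inner_apply]
    linear_combination (v 1) * h

/-- The two-qubit state `cos χ |00⟩ + sin χ |11⟩`. -/
def schmidtState (χ : ℝ) :
    EuclideanSpace ℂ (Fin 2) ⊗[ℂ] EuclideanSpace ℂ (Fin 2) :=
  EuclideanSpace.single 0 (Real.cos χ : ℂ) ⊗ₜ EuclideanSpace.single 0 1
    + EuclideanSpace.single 1 (Real.sin χ : ℂ) ⊗ₜ EuclideanSpace.single 1 1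

theorem inner_schmidtState (χ : ℝ) : ⟪schmidtState χ, schmidtState χ⟫_ℂ = 1 := by
  simp only [schmidtState, inner_add_left, inner_add_right, TensorProduct.inner_tmul,
    PiLp.inner_apply, Fin.sum_univ_two]
  simp [-Complex.ofReal_cos, -Complex.ofReal_sin]
  norm_cast
  rw [sq_abs, sq_abs, Real.cos_sq_add_sin_sq]

/-- The amplitude of the outcome `(a, b)` for measurement angles `α`, `β`. -/
def amplitude (χ α β : ℝ) (a b : Fin 2) : ℝ :=
  Real.cos χ * (qubit α a 0 * qubit β b 0) + Real.sin χ * (qubit α a 1 * qubit β b 1)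

theorem inner_schmidtState_mapL (χ α β : ℝ) (a b : Fin 2) :
    ⟪schmidtState χ, TensorProduct.mapL (qubitMeasurement α a) (qubitMeasurement β b)
      (schmidtState χ)⟫_ℂ = ((amplitude χ α β a b ^ 2 : ℝ) : ℂ) := by
  simp only [schmidtState, map_add, TensorProduct.mapL_tmul, inner_add_left, inner_add_right,
    TensorProduct.inner_tmul, qubitMeasurement, InnerProductSpace.rankOne_apply, qubitVector,
    PiLp.inner_apply, Fin.sum_univ_two]
  simp [amplitude, -Complex.ofReal_cos, -Complex.ofReal_sin]
  ring

theorem isQuantum_amplitude (χ : ℝ) (α β : Fin 2 → ℝ) :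
    IsQuantum fun a b x y => amplitude χ (α x) (β y) a b ^ 2 := by
  set ψ : HTensor (EuclideanSpace ℂ (Fin 2)) (EuclideanSpace ℂ (Fin 2)) :=
    ↑(schmidtState χ) with hψ
  have hnorm : ‖ψ‖ = 1 := by
    rw [hψ, UniformSpace.Completion.norm_coe, norm_eq_sqrt_re_inner (𝕜 := ℂ), inner_schmidtState]
    simp
  refine ⟨_, inferInstance, inferInstance, inferInstance, _, inferInstance, inferInstance,
    inferInstance, fun x => qubitMeasurement (α x), fun y => qubitMeasurement (β y),
    InnerProductSpace.rankOne ℂ ψ ψ, fun x => isPOVM_qubitMeasurement _,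
    fun y => isPOVM_qubitMeasurement _, isDensity_rankOne hnorm, fun a b x y => ?_⟩
  have h := hasTrace_comp_rankOne (opTensor (qubitMeasurement (α x) a) (qubitMeasurement (β y) b)) ψ
  rwa [hψ, opTensor_coe, UniformSpace.Completion.inner_coe, inner_schmidtState_mapL] at h

theorem correlator_amplitude (χ α β : ℝ) :
    amplitude χ α β 0 0 ^ 2 - amplitude χ α β 0 1 ^ 2 - amplitude χ α β 1 0 ^ 2
        + amplitude χ α β 1 1 ^ 2
      = Real.cos (2 * α) * Real.cos (2 * β)
        + Real.sin (2 * χ) * (Real.sin (2 * α) * Real.sin (2 * β)) := by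
  have h := Real.sin_sq χ
  simp only [amplitude, qubit, Real.cos_two_mul', Real.sin_two_mul, Matrix.cons_val_zero,
    Matrix.cons_val_one]
  linear_combination (Real.cos α ^ 2 - Real.sin α ^ 2) * (Real.cos β ^ 2 - Real.sin β ^ 2) * h

/-- Angles of Alice: the guessed measurement is the Schmidt basis. -/
def aliceAngle (xs x : Fin 2) : ℝ := if x = xs then 0 else Real.pi / 4

/-- Angles of Bob. -/
def bobAngle (μ : ℝ) (xs y : Fin 2) : ℝ :=
  if y = 0 then μ / 2 else if xs = 0 then -(μ / 2) else Real.pi / 2 - μ / 2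

/-- The behavior with the largest guessing probability among those with its score. -/
def optimalBehavior (χ μ : ℝ) (xs : Fin 2) : Behavior :=
  fun a b x y => amplitude χ (aliceAngle xs x) (bobAngle μ xs y) a b ^ 2

theorem score_eq_correlators (π : Fin 2 → Fin 2 → ℝ) (P : Behavior) :
    score π P = 4 * ∑ x : Fin 2, ∑ y : Fin 2, π x y * (-1 : ℝ) ^ (x.val * y.val) *
      (P 0 0 x y - P 0 1 x y - P 1 0 x y + P 1 1 x y) := by
  simp [score, Fin.sum_univ_two]
  ring

theorem score_optimalBehavior (χ μ r : ℝ) (xs : Fin 2) :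
    score (biasedInputs r xs) (optimalBehavior χ μ xs)
      = 4 * (r * Real.cos μ + (1 - r) * (Real.sin (2 * χ) * Real.sin μ)) := by
  have h1 : 2 * (μ / 2) = μ := by ring
  have h2 : 2 * (Real.pi / 4) = Real.pi / 2 := by ring
  have h3 : 2 * (Real.pi / 2 - μ / 2) = Real.pi - μ := by ring
  have h4 : 2 * -(μ / 2) = -μ := by ring
  rw [score_eq_correlators]
  simp only [optimalBehavior, correlator_amplitude]
  rcases Fin.eq_zero_or_eq_succ xs with rfl | ⟨i, rfl⟩
  · simp [Fin.sum_univ_two, biasedInputs, aliceAngle, bobAngle, h1, h2, h4]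
    ring
  · obtain rfl : i = 0 := Subsingleton.elim _ _
    simp [Fin.sum_univ_two, biasedInputs, aliceAngle, bobAngle, h1, h2, h3]
    ring

theorem marginal_optimalBehavior (χ μ : ℝ) (xs : Fin 2) :
    marginal (optimalBehavior χ μ xs) 0 xs = Real.cos χ ^ 2 ∧
      marginal (optimalBehavior χ μ xs) 1 xs = Real.sin χ ^ 2 := by
  have h := Real.cos_sq_add_sin_sq (μ / 2)
  constructor
  · simp [marginal, optimalBehavior, Fin.sum_univ_two, amplitude, qubit, aliceAngle, bobAngle]
    linear_combination Real.cos χ ^ 2 * h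
  · simp [marginal, optimalBehavior, Fin.sum_univ_two, amplitude, qubit, aliceAngle, bobAngle]
    linear_combination Real.sin χ ^ 2 * h

theorem mem_guessingValues_of_isQuantum {V : Behavior → ℝ} {xs : Fin 2} {S : ℝ} {P : Behavior}
    (hP : IsQuantum P) (hV : V P = S) :
    max (marginal P 0 xs) (marginal P 1 xs) ∈ guessingValues V xs S := by
  refine ⟨Unit, fun _ => 1, fun _ => P, fun _ => zero_le_one, ?_, fun _ => hP, ?_, ?_⟩
  · simp
  · have : average (fun _ : Unit => (1 : ℝ)) (fun _ => P) = P := by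
      funext a b x y
      simp [average]
    rw [this, hV]
  · simp

theorem guessFormula_mem {xs : Fin 2} {r S : ℝ} (hr : 1 / 2 ≤ r) (hr' : r < 1)
    (hS : S ∈ Set.Icc (4 * r) (4 * √(r ^ 2 + (1 - r) ^ 2))) :
    guessFormula r S ∈ guessingValues (score (biasedInputs r xs)) xs S := by
  obtain ⟨hS₁, hS₂⟩ := hS
  have hr0 : 0 < r := by linarith
  have hr1 : 0 < 1 - r := by linarith
  set T := S / 4 with hT
  have hT0 : 0 < T := by linarith
  have hrT : r ≤ T := by linarith
  have hTsq : T ^ 2 ≤ r ^ 2 + (1 - r) ^ 2 := Real.le_sqrt' hT0 |>.1 (by linarith)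
  have hD0 : 0 ≤ 1 / (1 - r) ^ 2 * (T ^ 2 - r ^ 2) := by
    have : r ^ 2 ≤ T ^ 2 := by gcongr
    have := sub_nonneg.2 this
    positivity
  have hD1 : 1 / (1 - r) ^ 2 * (T ^ 2 - r ^ 2) ≤ 1 := by
    rw [one_div_mul_eq_div, div_le_one (by positivity)]
    linarith
  set s := √(1 / (1 - r) ^ 2 * (T ^ 2 - r ^ 2)) with hs
  have hssq : s ^ 2 = 1 / (1 - r) ^ 2 * (T ^ 2 - r ^ 2) := Real.sq_sqrt hD0
  have hs0 : 0 ≤ s := Real.sqrt_nonneg _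
  have hs1 : s ≤ 1 := Real.sqrt_le_one.2 hD1
  have hTs : T ^ 2 = r ^ 2 + ((1 - r) * s) ^ 2 := by
    rw [mul_pow, hssq]; field_simp; ring
  -- For fixed `χ` the score over 4 is `r cos μ + (1 - r) sin 2χ sin μ`, with maximum `√(r² + (1 -
  -- r)² sin² 2χ)` over `μ`. Equating this to `T` forces `sin² 2χ = s²`, and the maximizing `μ` has
  -- `cos μ = r / T`. The endpoints of the range of `S` correspond to `s = 0` and `s = 1`.
  set χ := Real.arcsin s / 2 with hχ
  set μ := Real.arccos (r / T) with hμ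
  have h2χ : 2 * χ = Real.arcsin s := by rw [hχ]; ring
  have hsin : Real.sin (2 * χ) = s := by rw [h2χ, Real.sin_arcsin (by linarith) hs1]
  have hcos : Real.cos (2 * χ) = √(1 - s ^ 2) := by rw [h2χ, Real.cos_arcsin]
  have hcosμ : Real.cos μ = r / T :=
    Real.cos_arccos (by have : 0 < r / T := by positivity
                        linarith) ((div_le_one hT0).2 hrT)
  have hsinμ : Real.sin μ = (1 - r) * s / T := by
    have h : 1 - (r / T) ^ 2 = ((1 - r) * s / T) ^ 2 := by
      field_simp
      linarith
    rw [hμ, Real.sin_arccos, h, Real.sqrt_sq (by positivity)]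
  have hscore : score (biasedInputs r xs) (optimalBehavior χ μ xs) = S := by
    rw [score_optimalBehavior, hsin, hcosμ, hsinμ]
    have : r * (r / T) + (1 - r) * (s * ((1 - r) * s / T)) = T := by
      field_simp
      linarith
    rw [this, hT]; ring
  have hmem := mem_guessingValues_of_isQuantum (P := optimalBehavior χ μ xs) (xs := xs)
    (isQuantum_amplitude χ (aliceAngle xs) (bobAngle μ xs)) hscore
  obtain ⟨h0, h1⟩ := marginal_optimalBehavior χ μ xs
  rw [h0, h1, max_eq_of_add_eq_one (Real.cos_sq_add_sin_sq χ), ← Real.cos_two_mul', hcos,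
    abs_of_nonneg (Real.sqrt_nonneg _), hssq] at hmem
  exact hmem

end BiasedCHSH

end

theorem mainTheorem3 (xs : Fin 2) :
    (∀ r : ℝ, 1 / 2 ≤ r → r < 1 →
      ∀ S ∈ Set.Icc (4 * r) (4 * √(r ^ 2 + (1 - r) ^ 2)),
        IsGreatest
          (BiasedCHSH.guessingValues
            (BiasedCHSH.score (BiasedCHSH.biasedInputs r xs)) xs S)
          (BiasedCHSH.guessFormula r S)) ∧
    (∀ P : BiasedCHSH.Behavior,
      BiasedCHSH.score (BiasedCHSH.biasedInputs (1 / 2) xs) P = BiasedCHSH.chsh P) ∧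
    (∀ S : ℝ, BiasedCHSH.guessFormula (1 / 2) S = 1 / 2 * (1 + √(2 - (S / 2) ^ 2))) := by
  refine ⟨fun r hr hr' S hS => ⟨BiasedCHSH.guessFormula_mem hr hr' hS,
    fun g hg => BiasedCHSH.guessingValues_le hr hr' hS.1 hg⟩, fun P => ?_, fun S => ?_⟩
  · have h : ∀ x y, BiasedCHSH.biasedInputs (1 / 2) xs x y = 1 / 4 := fun x y => by
      rw [BiasedCHSH.biasedInputs]
      split_ifs <;> norm_num
    simp only [BiasedCHSH.score, BiasedCHSH.chsh, h, Finset.mul_sum]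
    refine Finset.sum_congr rfl fun a _ => Finset.sum_congr rfl fun b _ =>
      Finset.sum_congr rfl fun x _ => Finset.sum_congr rfl fun y _ => ?_
    ring
  · rw [BiasedCHSH.guessFormula]
    congr 3
    ring
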